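/- \textbf{Theorem.} Let $G$ be a finite connected simple graph that is outerplanar, that is, $G$ has a plane embedding (edges drawn as polygonal curves that meet only in common end-vertices) with every vertex on the boundary of the unbounded face. Then $c_H(G)\le 2$. Here the hyperopic cop number $c_H(G)$ is the least number $k$ such that $k$ cops have a winning strategy in the game of Hyperopic Cops and Robbers on $G$, which is played as follows. First each cop chooses a vertex (several cops may share a vertex), and then the robber chooses a vertex. In each round every cop passes or moves to a neighbouring vertex, and after that the robber passes or moves to a neighbouring vertex. The robber always sees the cops. The cops know the graph and remember what they have seen; they see the vertex of the robber at every time of the game (after each step of either player) except when the robber is adjacent to all of the cops, in which case the robber is invisible. A robber on the same vertex as a cop is visible and is captured. A strategy of the cops prescribes their positions as a function of what they have seen so far. It is winning if every play of the robber against it ends with a capture after finitely many rounds and no chance is involved in the capture: if the robber is captured by a move of the cops, then that move captures the robber in every play of the robber that is consistent with what the cops have seen up to that moment. -/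

import Mathlib

/-! ### Outerplanar graphs -/

/-- `IsPolygonalCurve a b S`: the set `S` is a polygonal curve in the plane from `a` to `b`, that is,
a finite chain of line segments, each starting where the previous one ends. It need not be simple:
this makes no difference below, since a simple polygonal curve from `a` to `b` (for `a ≠ b`) can be
found inside `S`. -/
inductive IsPolygonalCurve : ℝ × ℝ → ℝ × ℝ → Set (ℝ × ℝ) → Prop
  | single (a b : ℝ × ℝ) : IsPolygonalCurve a b (segment ℝ a b)
  | cons (a b c : ℝ × ℝ) (S : Set (ℝ × ℝ)) :
      IsPolygonalCurve b c S → IsPolygonalCurve a c (segment ℝ a b ∪ S)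

/-- A plane embedding of `G`: a drawing in the plane without crossings. Only the values of `curve`
at edges of `G` matter. -/
structure PlaneEmbedding {V : Type*} (G : SimpleGraph V) where
  point : V → ℝ × ℝ
  curve : Sym2 V → Set (ℝ × ℝ)
  point_injective : Function.Injective point
  polygonal : ∀ u v : V, G.Adj u v → IsPolygonalCurve (point u) (point v) (curve s(u, v))
  /-- An edge contains no vertex other than its ends. -/
  mem_of_point_mem : ∀ e ∈ G.edgeSet, ∀ w : V, point w ∈ curve e → w ∈ e
  /-- Two distinct edges meet only in common ends. -/
  inter_subset : ∀ e ∈ G.edgeSet, ∀ e' ∈ G.edgeSet, e ≠ e' →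
    ∀ x ∈ curve e ∩ curve e', ∃ w : V, w ∈ e ∧ w ∈ e' ∧ x = point w

/-- The set of points of the plane used by the embedding. -/
def PlaneEmbedding.carrier {V : Type*} {G : SimpleGraph V} (E : PlaneEmbedding G) : Set (ℝ × ℝ) :=
  Set.range E.point ∪ ⋃ e ∈ G.edgeSet, E.curve e

/-- The faces of the embedding are the connected components of the complement of the drawing. -/
def PlaneEmbedding.IsFace {V : Type*} {G : SimpleGraph V} (E : PlaneEmbedding G)
    (F : Set (ℝ × ℝ)) : Prop :=
  ∃ x ∈ E.carrierᶜ, F = connectedComponentIn E.carrierᶜ x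

/-- A graph is outerplanar if it has a plane embedding with every vertex on the boundary of the
unbounded face. -/
def IsOuterplanar {V : Type*} (G : SimpleGraph V) : Prop :=
  ∃ (E : PlaneEmbedding G) (F : Set (ℝ × ℝ)),
    E.IsFace F ∧ ¬ Bornology.IsBounded F ∧ ∀ v : V, E.point v ∈ frontier F

/-! ### Hyperopic Cops and Robbers -/

/-- A player on `u` may move to `v` in one step: either pass, or move along an edge. -/
def MayMove {V : Type*} (G : SimpleGraph V) (u v : V) : Prop := u = v ∨ G.Adj u v

/-- The robber on `r` is invisible to the cops on `c` if they are adjacent to all the cops. (Graphs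
are loopless here, so a robber on the vertex of a cop is visible.) -/
def Invisible {V : Type*} (G : SimpleGraph V) {k : ℕ} (c : Fin k → V) (r : V) : Prop :=
  ∀ i, G.Adj (c i) r

open Classical in
/-- What the cops see of the robber: their vertex if they are visible, nothing otherwise. -/
noncomputable def observe {V : Type*} (G : SimpleGraph V) {k : ℕ} (c : Fin k → V) (r : V) :
    Option V :=
  if Invisible G c r then none else some r

/-- A strategy of `k` cops: the positions that they take next, given everything they have observed
so far (the latest observation first). The initial positions are the value at `[]`. The previous
positions of the cops are determined by the strategy and the observations. -/
abbrev CopStrategy (V : Type*) (k : ℕ) : Type _ := List (Option V) → Fin k → V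

/-- A play of the robber: `r 0` is the initial position and `r n` the position after round `n`. -/
def IsRobberPlay {V : Type*} (G : SimpleGraph V) (r : ℕ → V) : Prop :=
  ∀ n, MayMove G (r n) (r (n + 1))

/-- The observations that the cops have made once the robber has taken position `r n`. The cops
observe after each step: after the robber's initial placement, and in each round once after the
move of the cops and once more after the move of the robber. -/
noncomputable def observations {V : Type*} (G : SimpleGraph V) {k : ℕ} (σ : CopStrategy V k)
    (r : ℕ → V) : ℕ → List (Option V)
  | 0 => [observe G (σ []) (r 0)]
  | n + 1 =>
    observe G (σ (observations G σ r n)) (r (n + 1)) ::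
      observe G (σ (observations G σ r n)) (r n) :: observations G σ r n

/-- The positions of the cops: `copPosition G σ r 0` is the initial one, and the `n`-th one is taken
in round `n`, as a reply to `r (n - 1)`. -/
noncomputable def copPosition {V : Type*} (G : SimpleGraph V) {k : ℕ} (σ : CopStrategy V k)
    (r : ℕ → V) : ℕ → Fin k → V
  | 0 => σ []
  | n + 1 => σ (observations G σ r n)

/-- The robber takes position `r n` and there is a cop on it. -/
def CaughtOnArrival {V : Type*} (G : SimpleGraph V) {k : ℕ} (σ : CopStrategy V k) (r : ℕ → V)
    (n : ℕ) : Prop :=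
  ∃ i, copPosition G σ r n i = r n

/-- In round `n + 1` a cop moves onto the position `r n` of the robber. -/
def CaughtByMove {V : Type*} (G : SimpleGraph V) {k : ℕ} (σ : CopStrategy V k) (r : ℕ → V)
    (n : ℕ) : Prop :=
  ∃ i, copPosition G σ r (n + 1) i = r n

/-- The move of the cops in round `n + 1` is guaranteed to capture the robber: it captures them in
every play that agrees with what the cops have observed. -/
def SurelyCaughtByMove {V : Type*} (G : SimpleGraph V) {k : ℕ} (σ : CopStrategy V k) (r : ℕ → V)
    (n : ℕ) : Prop :=
  ∀ r' : ℕ → V, IsRobberPlay G r' → observations G σ r' n = observations G σ r n →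
    CaughtByMove G σ r' n

/-- A strategy of the cops wins if it makes only legal moves and every play of the robber ends with
a capture in which no chance is involved: the first time that the robber and a cop are on the same
vertex, either the robber has just gone there (so that they are visible), or the move of the cops
was guaranteed to capture them. -/
def IsWinningStrategy {V : Type*} (G : SimpleGraph V) {k : ℕ} (σ : CopStrategy V k) : Prop :=
  ∀ r : ℕ → V, IsRobberPlay G r →
    (∀ n i, MayMove G (copPosition G σ r n i) (copPosition G σ r (n + 1) i)) ∧
    ∃ n, (∀ m < n, ¬ CaughtOnArrival G σ r m ∧ ¬ CaughtByMove G σ r m) ∧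
      (CaughtOnArrival G σ r n ∨ SurelyCaughtByMove G σ r n)

/-- The hyperopic cop number: the least number of cops with a winning strategy (and `⊤` if there is
no such number, which does not happen in a finite graph). -/
noncomputable def hyperopicCopNumber {V : Type*} (G : SimpleGraph V) : ℕ∞ :=
  sInf {N : ℕ∞ | ∃ k : ℕ, N = k ∧ ∃ σ : CopStrategy V k, IsWinningStrategy G σ}

/-!
Two cops who are always on different vertices when it is their turn lose nothing by the robber's
invisibility. Indeed, two vertices of an outerplanar graph have at most two common neighbours, so
that a robber who is invisible at that time is captured for sure by sending one cop to each of
them (`IsOuterplanar.eq_or_eq_of_common_neighbors`); and a robber who was visible after their own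
move has a known position when the cops reply. It remains to win the game with a visible robber,
under the restriction that the cops do not meet (`exists_isWinningStrategy`).

For this, the cops on `u` and `v` confine the robber to a connected set `R` whose vertices have no
neighbours outside `R` other than `u` and `v`, and they shrink `R`
(`IsTerritory.exists_copsWin`). The essential invariant is that, if both cops are needed, `u` and
`v` are connected outside `R`. It guarantees a neighbour `w` of `u` in `R` such that no component
of `R - w` is adjacent to both `u` and `v` (`IsTerritory.exists_separating`). The cop on `u` moves
to `w`, which still guards its neighbour `u`; so either the cops on `w` and `v` confine the robber
to a smaller set already, or the cop on `v` is free to walk to `u`, and then the cops on `w` and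
`u` do so.

The only property of outerplanar graphs that is used is `IsOuterplanar.not_linked`: four vertices
cannot be linked by disjoint walks in all three ways of pairing them up. Otherwise the walks and
four curves from a point of the unbounded face to the four vertices would form a drawing of the
complete graph on five vertices in which curves without a common end are disjoint. Such a drawing
is impossible by a parity argument. For two polygonal curves, the parity of the number of crossings
is expressed through the parities of their crossings with the vertical rays from the ends of the
other curve (`crossParity`). It vanishes for disjoint curves, as is seen by separating disjoint
segments by a line, while its sum over the fifteen pairs of curves without a common end is odd
(`not_disjoint_drawing_of_five_points`).
-/

/-! ### Crossing parities of polygonal curves -/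

/-- The indicator, modulo 2, of `p ≤ x` in the lexicographic order of the plane. -/
noncomputable def lexInd (p x : ℝ × ℝ) : ZMod 2 :=
  if toLex p ≤ toLex x then 1 else 0

/-- Twice the signed area of the triangle `p q x`; for `p` to the left of `q`, it is negative
exactly if `x` is below the line through `p` and `q`. -/
def area (p q x : ℝ × ℝ) : ℝ :=
  (q.1 - p.1) * (x.2 - p.2) - (q.2 - p.2) * (x.1 - p.1)

open Classical in
/-- The parity of the number of crossings of the segment `p q` with the upward ray from `x`.
Abscissae are compared in the lexicographic order, as if the plane had been sheared by an
infinitesimal amount: no general position is needed, and vertical segments do not count. -/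
noncomputable def rayCross (p q x : ℝ × ℝ) : ZMod 2 :=
  if (toLex p ≤ toLex x ∧ toLex x < toLex q ∧ area p q x < 0) ∨
    (toLex q ≤ toLex x ∧ toLex x < toLex p ∧ area q p x < 0) then 1 else 0

/-- `PolygonalChain a b S f`: the set `S` is traced by a polygonal curve from `a` to `b`, and `f x`
is the parity of the number of its crossings with the upward ray from `x`. -/
inductive PolygonalChain : ℝ × ℝ → ℝ × ℝ → Set (ℝ × ℝ) → (ℝ × ℝ → ZMod 2) → Prop
  | single (a b : ℝ × ℝ) : PolygonalChain a b (segment ℝ a b) (rayCross a b)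
  | trans {a b c : ℝ × ℝ} {S T : Set (ℝ × ℝ)} {f g : ℝ × ℝ → ZMod 2} :
      PolygonalChain a b S f → PolygonalChain b c T g → PolygonalChain a c (S ∪ T) (f + g)

theorem lexInd_swap {p x : ℝ × ℝ} (h : p ≠ x) : lexInd x p = 1 + lexInd p x := by
  have h' : toLex p ≠ toLex x := fun e => h (toLex.injective e)
  unfold lexInd
  rcases lt_or_gt_of_ne h' with h1 | h1
  · rw [if_neg (not_le.2 h1), if_pos h1.le]; decide
  · rw [if_pos h1.le, if_neg (not_le.2 h1)]; decide

theorem lexInd_of_le {p x : ℝ × ℝ} (h : toLex p ≤ toLex x) : lexInd p x = 1 := if_pos h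

theorem lexInd_of_lt {p x : ℝ × ℝ} (h : toLex x < toLex p) : lexInd p x = 0 := if_neg (not_le.2 h)

theorem rayCross_comm (p q x : ℝ × ℝ) : rayCross p q x = rayCross q p x := by
  unfold rayCross
  simp only [or_comm]

/-- A point that is separated from the segment `p q` by a line and lies above that line is above
the segment. -/
theorem area_pos_of_separated {m n c : ℝ} (hn : 0 < n) {p q x : ℝ × ℝ}
    (hp : m * p.1 + n * p.2 < c) (hq : m * q.1 + n * q.2 < c) (hx : c < m * x.1 + n * x.2)
    (h1 : toLex p ≤ toLex x) (h2 : toLex x < toLex q) : 0 < area p q x := by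
  rw [Prod.Lex.toLex_le_toLex] at h1
  rw [Prod.Lex.toLex_lt_toLex] at h2
  have h1' : p.1 ≤ x.1 := by rcases h1 with h | h <;> linarith
  have h2' : x.1 ≤ q.1 := by rcases h2 with h | h <;> linarith
  have key : n * area p q x = (q.1 - x.1) * ((m * x.1 + n * x.2) - (m * p.1 + n * p.2)) +
      (x.1 - p.1) * ((m * x.1 + n * x.2) - (m * q.1 + n * q.2)) := by
    unfold area; ring
  refine pos_of_mul_pos_right (a := n) ?_ hn.le
  rw [key]
  rcases h2 with h | ⟨h, h'⟩
  · have : 0 < (q.1 - x.1) * ((m * x.1 + n * x.2) - (m * p.1 + n * p.2)) :=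
      mul_pos (by linarith) (by linarith)
    have : 0 ≤ (x.1 - p.1) * ((m * x.1 + n * x.2) - (m * q.1 + n * q.2)) :=
      mul_nonneg (by linarith) (by linarith)
    linarith
  · exfalso
    have := mul_lt_mul_of_pos_left h' hn
    rw [h] at hx
    linarith

/-- The mirror image of `area_pos_of_separated`. -/
theorem area_neg_of_separated {m n c : ℝ} (hn : 0 < n) {p q x : ℝ × ℝ}
    (hp : c < m * p.1 + n * p.2) (hq : c < m * q.1 + n * q.2) (hx : m * x.1 + n * x.2 < c)
    (h1 : toLex p ≤ toLex x) (h2 : toLex x < toLex q) : area p q x < 0 := by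
  rw [Prod.Lex.toLex_le_toLex] at h1
  rw [Prod.Lex.toLex_lt_toLex] at h2
  have h1' : p.1 ≤ x.1 := by rcases h1 with h | h <;> linarith
  have h2' : x.1 ≤ q.1 := by rcases h2 with h | h <;> linarith
  have key : n * area p q x = (q.1 - x.1) * ((m * x.1 + n * x.2) - (m * p.1 + n * p.2)) +
      (x.1 - p.1) * ((m * x.1 + n * x.2) - (m * q.1 + n * q.2)) := by
    unfold area; ring
  by_contra hcon
  have h0 : 0 ≤ n * area p q x := mul_nonneg hn.le (not_lt.1 hcon)
  rw [key] at h0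
  have e1 : (q.1 - x.1) * ((m * x.1 + n * x.2) - (m * p.1 + n * p.2)) ≤ 0 :=
    mul_nonpos_of_nonneg_of_nonpos (by linarith) (by linarith)
  have e2 : (x.1 - p.1) * ((m * x.1 + n * x.2) - (m * q.1 + n * q.2)) ≤ 0 :=
    mul_nonpos_of_nonneg_of_nonpos (by linarith) (by linarith)
  have e3 : x.1 - p.1 = 0 := by
    have h3 : (x.1 - p.1) * ((m * x.1 + n * x.2) - (m * q.1 + n * q.2)) = 0 := by linarith
    rcases mul_eq_zero.1 h3 with h | h <;> linarith
  rcases h1 with h | ⟨h, h'⟩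
  · linarith
  · have := mul_le_mul_of_nonneg_left h' hn.le
    rw [h] at hp
    linarith

theorem rayCross_eq_zero_of_separated {m n c : ℝ} (hn : 0 < n) {p q x : ℝ × ℝ}
    (hp : m * p.1 + n * p.2 < c) (hq : m * q.1 + n * q.2 < c) (hx : c < m * x.1 + n * x.2) :
    rayCross p q x = 0 := by
  unfold rayCross
  rw [if_neg]
  rintro (⟨h1, h2, h3⟩ | ⟨h1, h2, h3⟩)
  · exact lt_asymm h3 (area_pos_of_separated hn hp hq hx h1 h2)
  · exact lt_asymm h3 (area_pos_of_separated hn hq hp hx h1 h2)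

theorem rayCross_eq_lexInd_of_separated {m n c : ℝ} (hn : 0 < n) {p q x : ℝ × ℝ}
    (hp : c < m * p.1 + n * p.2) (hq : c < m * q.1 + n * q.2) (hx : m * x.1 + n * x.2 < c) :
    rayCross p q x = lexInd p x + lexInd q x := by
  rcases le_or_gt (toLex p) (toLex x) with h1 | h1 <;>
    rcases le_or_gt (toLex q) (toLex x) with h2 | h2
  · rw [lexInd_of_le h1, lexInd_of_le h2, rayCross, if_neg]
    · decide
    · rintro (⟨-, h, -⟩ | ⟨-, h, -⟩)
      · exact absurd h (not_lt.2 h2)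
      · exact absurd h (not_lt.2 h1)
  · rw [lexInd_of_le h1, lexInd_of_lt h2, rayCross,
      if_pos (Or.inl ⟨h1, h2, area_neg_of_separated hn hp hq hx h1 h2⟩), add_zero]
  · rw [lexInd_of_lt h1, lexInd_of_le h2, rayCross,
      if_pos (Or.inr ⟨h2, h1, area_neg_of_separated hn hq hp hx h2 h1⟩), zero_add]
  · rw [lexInd_of_lt h1, lexInd_of_lt h2, rayCross, if_neg, add_zero]
    rintro (⟨h, -, -⟩ | ⟨h, -, -⟩)
    · exact absurd h (not_le.2 h1)
    · exact absurd h (not_le.2 h2)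

/-- The crossing parity of two curves, from `a` to `a'` and from `b` to `b'`, with ray parities `f`
and `g`. For segments in general position it is the number of their crossings: over the common
abscissae of the two segments, one compares which is on top at both ends. The point of the formula
is that it depends on the curves through their ends only, apart from `f` and `g`. -/
noncomputable def crossParity (a a' : ℝ × ℝ) (f : ℝ × ℝ → ZMod 2) (b b' : ℝ × ℝ)
    (g : ℝ × ℝ → ZMod 2) : ZMod 2 :=
  f b + f b' + g a + g a' + (lexInd b a + lexInd b' a + lexInd b a' + lexInd b' a')

theorem crossParity_segment {p q x y : ℝ × ℝ} (h : Disjoint (segment ℝ p q) (segment ℝ x y)) :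
    crossParity p q (rayCross p q) x y (rayCross x y) = 0 := by
  have cpt : ∀ a b : ℝ × ℝ, IsCompact (segment ℝ a b) := fun a b => by
    rw [← convexHull_pair]; exact (Set.toFinite {a, b}).isCompact_convexHull ℝ
  obtain ⟨φ, s, t, h1, hst, h2⟩ := geometric_hahn_banach_compact_closed (convex_segment p q)
    (cpt p q) (convex_segment x y) (cpt x y).isClosed h
  set m := φ (1, 0)
  set n := φ (0, 1)
  have hφ : ∀ w : ℝ × ℝ, φ w = m * w.1 + n * w.2 := by
    intro w
    have : w = w.1 • ((1, 0) : ℝ × ℝ) + w.2 • ((0, 1) : ℝ × ℝ) := by ext <;> simp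
    conv_lhs => rw [this]
    rw [map_add, map_smul, map_smul, smul_eq_mul, smul_eq_mul]; ring
  have hp : m * p.1 + n * p.2 < s := hφ p ▸ h1 p (left_mem_segment ℝ p q)
  have hq : m * q.1 + n * q.2 < s := hφ q ▸ h1 q (right_mem_segment ℝ p q)
  have hx : s < m * x.1 + n * x.2 := hst.trans (hφ x ▸ h2 x (left_mem_segment ℝ x y))
  have hy : s < m * y.1 + n * y.2 := hst.trans (hφ y ▸ h2 y (right_mem_segment ℝ x y))
  have hpx : p ≠ x := by rintro rfl; linarith
  have hpy : p ≠ y := by rintro rfl; linarith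
  have hqx : q ≠ x := by rintro rfl; linarith
  have hqy : q ≠ y := by rintro rfl; linarith
  unfold crossParity
  rcases lt_trichotomy n 0 with hn | hn | hn
  · rw [rayCross_eq_zero_of_separated (m := -m) (n := -n) (c := -s) (p := x) (q := y) (x := p),
      rayCross_eq_zero_of_separated (m := -m) (n := -n) (c := -s) (p := x) (q := y) (x := q),
      rayCross_eq_lexInd_of_separated (m := -m) (n := -n) (c := -s) (p := p) (q := q) (x := x),
      rayCross_eq_lexInd_of_separated (m := -m) (n := -n) (c := -s) (p := p) (q := q) (x := y),
      lexInd_swap hpx, lexInd_swap hpy, lexInd_swap hqx, lexInd_swap hqy]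
    · generalize lexInd p x = A
      generalize lexInd p y = B
      generalize lexInd q x = C
      generalize lexInd q y = D
      revert A B C D
      decide
    all_goals linarith
  · -- a vertical line separates the segments, so that no ray from one of them meets the other
    rw [hn] at hp hq hx hy
    have lex : ∀ a b : ℝ × ℝ, a.1 < b.1 → toLex a < toLex b := fun a b hab =>
      Prod.Lex.toLex_lt_toLex.2 (Or.inl hab)
    have z : ∀ a b w : ℝ × ℝ, (toLex w < toLex a ∧ toLex w < toLex b ∨
        toLex a < toLex w ∧ toLex b < toLex w) → rayCross a b w = 0 := by
      intro a b w hw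
      unfold rayCross
      rw [if_neg]
      rintro (⟨h3, h4, -⟩ | ⟨h3, h4, -⟩) <;> rcases hw with ⟨h5, h6⟩ | ⟨h5, h6⟩
      · exact absurd h3 (not_le.2 h5)
      · exact lt_asymm h4 h6
      · exact absurd h3 (not_le.2 h6)
      · exact lt_asymm h4 h5
    rcases lt_trichotomy m 0 with hm | hm | hm
    · have o : ∀ a b : ℝ × ℝ, m * a.1 + 0 * a.2 < s → s < m * b.1 + 0 * b.2 →
          toLex b < toLex a := fun a b ha hb => lex b a (by nlinarith)
      rw [z p q x (.inl ⟨o _ _ hp hx, o _ _ hq hx⟩), z p q y (.inl ⟨o _ _ hp hy, o _ _ hq hy⟩),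
        z x y p (.inr ⟨o _ _ hp hx, o _ _ hp hy⟩), z x y q (.inr ⟨o _ _ hq hx, o _ _ hq hy⟩),
        lexInd_of_le (o _ _ hp hx).le, lexInd_of_le (o _ _ hp hy).le,
        lexInd_of_le (o _ _ hq hx).le, lexInd_of_le (o _ _ hq hy).le]
      decide
    · rw [hm] at hp hx; linarith
    · have o : ∀ a b : ℝ × ℝ, m * a.1 + 0 * a.2 < s → s < m * b.1 + 0 * b.2 →
          toLex a < toLex b := fun a b ha hb => lex a b (by nlinarith)
      rw [z p q x (.inr ⟨o _ _ hp hx, o _ _ hq hx⟩), z p q y (.inr ⟨o _ _ hp hy, o _ _ hq hy⟩),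
        z x y p (.inl ⟨o _ _ hp hx, o _ _ hp hy⟩), z x y q (.inl ⟨o _ _ hq hx, o _ _ hq hy⟩),
        lexInd_of_lt (o _ _ hp hx), lexInd_of_lt (o _ _ hp hy),
        lexInd_of_lt (o _ _ hq hx), lexInd_of_lt (o _ _ hq hy)]
      decide
  · rw [rayCross_eq_zero_of_separated hn hp hq hx, rayCross_eq_zero_of_separated hn hp hq hy,
      rayCross_eq_lexInd_of_separated hn hx hy hp, rayCross_eq_lexInd_of_separated hn hx hy hq]
    generalize lexInd x p = A
    generalize lexInd y p = B
    generalize lexInd x q = C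
    generalize lexInd y q = D
    revert A B C D
    decide

theorem crossParity_trans_left (a m c : ℝ × ℝ) (f f' : ℝ × ℝ → ZMod 2) (b b' : ℝ × ℝ)
    (g : ℝ × ℝ → ZMod 2) :
    crossParity a c (f + f') b b' g = crossParity a m f b b' g + crossParity m c f' b b' g := by
  unfold crossParity
  simp only [Pi.add_apply]
  linear_combination -CharTwo.add_self_eq_zero (g m + lexInd b m + lexInd b' m)

theorem crossParity_trans_right (b m c : ℝ × ℝ) (g g' : ℝ × ℝ → ZMod 2) (a a' : ℝ × ℝ)
    (f : ℝ × ℝ → ZMod 2) :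
    crossParity a a' f b c (g + g') = crossParity a a' f b m g + crossParity a a' f m c g' := by
  unfold crossParity
  simp only [Pi.add_apply]
  linear_combination -CharTwo.add_self_eq_zero (f m + lexInd m a + lexInd m a')

/-- Disjoint polygonal curves cross an even number of times. -/
theorem PolygonalChain.crossParity_eq_zero {a a' b b' : ℝ × ℝ} {S T : Set (ℝ × ℝ)}
    {f g : ℝ × ℝ → ZMod 2} (h : PolygonalChain a a' S f) (h' : PolygonalChain b b' T g)
    (hST : Disjoint S T) : crossParity a a' f b b' g = 0 := by
  induction h with
  | single p q =>
    induction h' with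
    | single x y => exact crossParity_segment hST
    | trans _ _ ih1 ih2 =>
      rw [Set.disjoint_union_right] at hST
      rw [crossParity_trans_right, ih1 hST.1, ih2 hST.2, add_zero]
  | trans _ _ ih1 ih2 =>
    rw [Set.disjoint_union_left] at hST
    rw [crossParity_trans_left, ih1 hST.1, ih2 hST.2, add_zero]

theorem PolygonalChain.symm {a b : ℝ × ℝ} {S : Set (ℝ × ℝ)} {f : ℝ × ℝ → ZMod 2}
    (h : PolygonalChain a b S f) : PolygonalChain b a S f := by
  induction h with
  | single a b =>
    rw [segment_symm, show rayCross a b = rayCross b a from funext (rayCross_comm a b)]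
    exact .single b a
  | trans _ _ ih1 ih2 => rw [Set.union_comm, add_comm]; exact ih2.trans ih1

/-- The complete graph on five vertices has no drawing by polygonal curves in which curves without
a common end are disjoint. Every ray parity occurs an even number of times in the sum of the
crossing parities over the fifteen pairs of such curves, and what remains is the number of pairs
for which the order of the ends is the reverse of the chosen one, which is odd. -/
theorem not_disjoint_drawing_of_five_points {z a b c d : ℝ × ℝ}
    {fza fzb fzc fzd fab fac fad fbc fbd fcd : ℝ × ℝ → ZMod 2}
    (ha : a ≠ b) (hb : a ≠ c) (hc : a ≠ d) (hd : b ≠ c) (he : b ≠ d) (hf : c ≠ d)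
    (hza : z ≠ a) (hzb : z ≠ b) (hzc : z ≠ c) (hzd : z ≠ d)
    (h1 : crossParity z a fza b c fbc = 0) (h2 : crossParity z a fza b d fbd = 0)
    (h3 : crossParity z a fza c d fcd = 0) (h4 : crossParity z b fzb a c fac = 0)
    (h5 : crossParity z b fzb a d fad = 0) (h6 : crossParity z b fzb c d fcd = 0)
    (h7 : crossParity z c fzc a b fab = 0) (h8 : crossParity z c fzc a d fad = 0)
    (h9 : crossParity z c fzc b d fbd = 0) (h10 : crossParity z d fzd a b fab = 0)
    (h11 : crossParity z d fzd a c fac = 0) (h12 : crossParity z d fzd b c fbc = 0)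
    (h13 : crossParity a b fab c d fcd = 0) (h14 : crossParity a c fac b d fbd = 0)
    (h15 : crossParity a d fad b c fbc = 0) : False := by
  unfold crossParity at *
  have e1 := lexInd_swap ha
  have e2 := lexInd_swap hb
  have e3 := lexInd_swap hc
  have e4 := lexInd_swap hd
  have e5 := lexInd_swap he
  have e6 := lexInd_swap hf
  have e7 := lexInd_swap hza
  have e8 := lexInd_swap hzb
  have e9 := lexInd_swap hzc
  have e10 := lexInd_swap hzd
  have two : (2 : ZMod 2) = 0 := rfl
  have : (1 : ZMod 2) = 0 := by grind
  exact one_ne_zero this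

/-! ### Four vertices on the boundary of a face -/

theorem IsPolygonalCurve.exists_chain {a b : ℝ × ℝ} {S : Set (ℝ × ℝ)}
    (h : IsPolygonalCurve a b S) : ∃ f, PolygonalChain a b S f := by
  induction h with
  | single a b => exact ⟨_, .single a b⟩
  | cons a b c S _ ih =>
    obtain ⟨f, hf⟩ := ih
    exact ⟨_, (PolygonalChain.single a b).trans hf⟩

theorem isClosed_segment_plane (a b : ℝ × ℝ) : IsClosed (segment ℝ a b) := by
  rw [← convexHull_pair]
  exact ((Set.toFinite {a, b}).isCompact_convexHull ℝ).isClosed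

theorem IsPolygonalCurve.isClosed {a b : ℝ × ℝ} {S : Set (ℝ × ℝ)}
    (h : IsPolygonalCurve a b S) : IsClosed S := by
  induction h with
  | single a b => exact isClosed_segment_plane a b
  | cons a b c S _ ih => exact (isClosed_segment_plane a b).union ih

theorem PolygonalChain.exists_of_isOpen {F : Set (ℝ × ℝ)} (hF : IsOpen F) (hc : IsPreconnected F)
    {x y : ℝ × ℝ} (hx : x ∈ F) (hy : y ∈ F) : ∃ S f, PolygonalChain x y S f ∧ S ⊆ F := by
  -- the transitive, symmetric relation of being joined inside `F` holds locally
  refine hc.induction₂ (fun x y => ∃ S f, PolygonalChain x y S f ∧ S ⊆ F) ?_ ?_ ?_ hx hy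
  · intro x hx
    obtain ⟨r, hr, hball⟩ := Metric.isOpen_iff.1 hF x hx
    filter_upwards [mem_nhdsWithin_of_mem_nhds (Metric.ball_mem_nhds x hr)] with y hy
    exact ⟨_, _, .single x y,
      ((convex_ball x r).segment_subset (Metric.mem_ball_self hr) hy).trans hball⟩
  · rintro x y z _ _ _ ⟨S, f, h, hS⟩ ⟨T, g, h', hT⟩
    exact ⟨_, _, h.trans h', Set.union_subset hS hT⟩
  · rintro x y _ _ ⟨S, f, h, hS⟩
    exact ⟨_, _, h.symm, hS⟩

/-- The set `S` looks like a cone with apex `v` near `v`: a half-open segment from a nearby point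
outside `S` towards `v` does not meet `S`. -/
def IsConicAt (v : ℝ × ℝ) (S : Set (ℝ × ℝ)) : Prop :=
  ∀ᶠ p in nhds v, p ∉ S → ∀ t ∈ Set.Ico (0 : ℝ) 1, AffineMap.lineMap p v t ∉ S

theorem IsConicAt.union {v : ℝ × ℝ} {S T : Set (ℝ × ℝ)} (hS : IsConicAt v S)
    (hT : IsConicAt v T) : IsConicAt v (S ∪ T) := by
  filter_upwards [hS, hT] with p h1 h2 hp t ht
  rw [Set.mem_union, not_or] at hp ⊢
  exact ⟨h1 hp.1 t ht, h2 hp.2 t ht⟩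

theorem IsConicAt.biUnion {ι : Type*} {v : ℝ × ℝ} {I : Set ι} (hI : I.Finite)
    {S : ι → Set (ℝ × ℝ)} (h : ∀ i ∈ I, IsConicAt v (S i)) : IsConicAt v (⋃ i ∈ I, S i) := by
  have := (Filter.eventually_all_finite hI).2 h
  filter_upwards [this] with p hp hpS t ht
  simp only [Set.mem_iUnion, not_exists] at hpS ⊢
  exact fun i hi => hp i hi (hpS i hi) t ht

theorem isConicAt_segment_of_apex (v s : ℝ × ℝ) : IsConicAt v (segment ℝ v s) := by
  by_cases hvs : s = v
  · subst hvs
    refine Filter.Eventually.of_forall fun p hp t ht => ?_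
    rw [segment_same, Set.mem_singleton_iff] at hp ⊢
    rw [AffineMap.lineMap_eq_right_iff]
    exact not_or.2 ⟨hp, ht.2.ne⟩
  have hpos : 0 < ‖s - v‖ := norm_pos_iff.2 (sub_ne_zero.2 hvs)
  filter_upwards [Metric.ball_mem_nhds v hpos] with p hp hpS t ht hmem
  apply hpS
  rw [segment_eq_image'] at hmem
  obtain ⟨τ, ⟨hτ0, -⟩, hτ⟩ := hmem
  have ht1 : 0 < 1 - t := by linarith [ht.2]
  have e : p - v = (τ / (1 - t)) • (s - v) := by
    have e1 : τ • (s - v) = (1 - t) • (p - v) := by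
      rw [AffineMap.lineMap_apply_module] at hτ
      have : τ • (s - v) = (1 - t) • p + t • v - v := by rw [← hτ]; simp
      rw [this]; module
    rw [div_eq_inv_mul, mul_smul, e1, smul_smul, inv_mul_cancel₀ ht1.ne', one_smul]
  have hq0 : 0 ≤ τ / (1 - t) := div_nonneg hτ0 ht1.le
  rw [segment_eq_image']
  refine ⟨τ / (1 - t), ⟨hq0, ?_⟩, by simp only [← e]; simp⟩
  rw [Metric.mem_ball, dist_eq_norm, e, norm_smul, Real.norm_of_nonneg hq0] at hp
  by_contra hcon
  nlinarith [not_le.1 hcon]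

theorem isConicAt_segment (v a b : ℝ × ℝ) : IsConicAt v (segment ℝ a b) := by
  by_cases hv : v ∈ segment ℝ a b
  · have e : segment ℝ a b = segment ℝ v a ∪ segment ℝ v b := by
      apply Set.Subset.antisymm
      · obtain ⟨s, hs, rfl⟩ := (segment_eq_image_lineMap ℝ a b) ▸ hv
        intro w hw
        obtain ⟨t, ht, rfl⟩ := (segment_eq_image_lineMap ℝ a b) ▸ hw
        rcases le_total t s with h | h
        · left
          rw [mem_segment_iff_wbtw]
          have : Wbtw ℝ (0:ℝ) t s := by rw [wbtw_iff_of_le hs.1]; exact ⟨ht.1, h⟩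
          have := this.map (AffineMap.lineMap a b : ℝ →ᵃ[ℝ] ℝ × ℝ)
          simpa using this.symm
        · right
          rw [mem_segment_iff_wbtw]
          have : Wbtw ℝ s t (1:ℝ) := by rw [wbtw_iff_of_le hs.2]; exact ⟨h, ht.2⟩
          have := this.map (AffineMap.lineMap a b : ℝ →ᵃ[ℝ] ℝ × ℝ)
          simpa using this
      · exact Set.union_subset
          ((convex_segment a b).segment_subset hv (left_mem_segment ℝ a b))
          ((convex_segment a b).segment_subset hv (right_mem_segment ℝ a b))
    rw [e]
    exact (isConicAt_segment_of_apex v a).union (isConicAt_segment_of_apex v b)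
  · obtain ⟨r, hr, hball⟩ := Metric.isOpen_iff.1 (isClosed_segment_plane a b).isOpen_compl v hv
    filter_upwards [Metric.ball_mem_nhds v hr] with p hp _ t ht
    apply hball
    apply (convex_ball v r).segment_subset hp (Metric.mem_ball_self hr)
    rw [segment_eq_image_lineMap]
    exact ⟨t, Set.Ico_subset_Icc_self ht, rfl⟩

theorem IsPolygonalCurve.isConicAt {a b : ℝ × ℝ} {S : Set (ℝ × ℝ)} (h : IsPolygonalCurve a b S)
    (v : ℝ × ℝ) : IsConicAt v S := by
  induction h with
  | single a b => exact isConicAt_segment v a b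
  | cons a b c S _ ih => exact (isConicAt_segment v a b).union ih

section Embedding

variable {V : Type*} {G : SimpleGraph V}

theorem PlaneEmbedding.carrier_eq (E : PlaneEmbedding G) :
    E.carrier = (⋃ v ∈ Set.univ, segment ℝ (E.point v) (E.point v)) ∪
      ⋃ e ∈ G.edgeSet, E.curve e := by
  unfold PlaneEmbedding.carrier
  congr 1
  ext x
  simp [eq_comm]

theorem PlaneEmbedding.isClosed_carrier [Finite V] (E : PlaneEmbedding G) : IsClosed E.carrier := by
  rw [E.carrier_eq]
  refine (Set.finite_univ.isClosed_biUnion fun v _ => isClosed_segment_plane _ _).union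
    ((Set.toFinite _).isClosed_biUnion fun e => ?_)
  induction e with
  | h u v => exact fun he => (E.polygonal u v he).isClosed

theorem PlaneEmbedding.isConicAt_carrier [Finite V] (E : PlaneEmbedding G) (x : ℝ × ℝ) :
    IsConicAt x E.carrier := by
  rw [E.carrier_eq]
  refine (IsConicAt.biUnion Set.finite_univ fun v _ => isConicAt_segment _ _ _).union
    (IsConicAt.biUnion (Set.toFinite _) fun e => ?_)
  induction e with
  | h u v => exact fun he => (E.polygonal u v he).isConicAt x

/-- Points on the boundary of a face are accessible from the face. -/
theorem PlaneEmbedding.exists_chain_of_mem_frontier [Finite V] (E : PlaneEmbedding G) {z v : ℝ × ℝ}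
    (hz : z ∈ E.carrierᶜ) (hv : v ∈ frontier (connectedComponentIn E.carrierᶜ z)) :
    ∃ S f, PolygonalChain z v S f ∧ S ⊆ insert v E.carrierᶜ := by
  have hopen : IsOpen E.carrierᶜ := E.isClosed_carrier.isOpen_compl
  obtain ⟨p, hpF, hp⟩ := mem_closure_iff_frequently.1 hv.1 |>.and_eventually
    (E.isConicAt_carrier v) |>.exists
  have hpc : p ∈ E.carrierᶜ := connectedComponentIn_subset _ _ hpF
  obtain ⟨S, f, h, hS⟩ := PolygonalChain.exists_of_isOpen hopen.connectedComponentIn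
    isPreconnected_connectedComponentIn (mem_connectedComponentIn hz) hpF
  refine ⟨_, _, h.trans (.single p v), Set.union_subset ?_ ?_⟩
  · exact (hS.trans (connectedComponentIn_subset _ _)).trans (Set.subset_insert _ _)
  · rw [segment_eq_image_lineMap]
    rintro _ ⟨t, ht, rfl⟩
    rcases ht.2.lt_or_eq with h1 | rfl
    · exact Or.inr (hp hpc t ⟨ht.1, h1⟩)
    · left; simp

/-- `LinkedIn G S a b`: there is a walk in `G` from `a` to `b` whose vertices, if `a ≠ b`, all
belong to `S`. -/
def LinkedIn {V : Type*} (G : SimpleGraph V) (S : Set V) : V → V → Prop :=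
  Relation.ReflTransGen fun x y => G.Adj x y ∧ x ∈ S ∧ y ∈ S

theorem PlaneEmbedding.exists_chain_of_linkedIn (E : PlaneEmbedding G) {S : Set V} {a b : V}
    (h : LinkedIn G S a b) (hab : a ≠ b) :
    ∃ A f, PolygonalChain (E.point a) (E.point b) A f ∧
      A ⊆ ⋃ e ∈ {e ∈ G.edgeSet | ∀ w ∈ e, w ∈ S}, E.curve e := by
  have h' := (Relation.reflTransGen_iff_eq_or_transGen.1 h).resolve_left hab.symm
  clear h hab
  have step : ∀ x y, G.Adj x y ∧ x ∈ S ∧ y ∈ S → ∃ A f,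
      PolygonalChain (E.point x) (E.point y) A f ∧
        A ⊆ ⋃ e ∈ {e ∈ G.edgeSet | ∀ w ∈ e, w ∈ S}, E.curve e := by
    rintro x y ⟨hxy, hx, hy⟩
    obtain ⟨f, hf⟩ := (E.polygonal x y hxy).exists_chain
    refine ⟨_, f, hf, Set.subset_biUnion_of_mem (u := fun e => E.curve e)
      (show s(x, y) ∈ {e ∈ G.edgeSet | ∀ w ∈ e, w ∈ S} from ⟨hxy, ?_⟩)⟩
    intro w hw
    rcases Sym2.mem_iff.1 hw with rfl | rfl <;> assumption
  induction h' with
  | single hxy => exact step _ _ hxy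
  | tail _ hxy ih =>
    obtain ⟨A, f, hA, hAS⟩ := ih
    obtain ⟨B, g, hB, hBS⟩ := step _ _ hxy
    exact ⟨_, _, hA.trans hB, Set.union_subset hAS hBS⟩

/-- The curves of two disjoint parts of a plane drawing are disjoint. -/
theorem PlaneEmbedding.disjoint_biUnion_curve (E : PlaneEmbedding G) {S T : Set V}
    (hST : Disjoint S T) :
    Disjoint (⋃ e ∈ {e ∈ G.edgeSet | ∀ w ∈ e, w ∈ S}, E.curve e)
      (⋃ e ∈ {e ∈ G.edgeSet | ∀ w ∈ e, w ∈ T}, E.curve e) := by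
  rw [Set.disjoint_left]
  intro x hx hx'
  simp only [Set.mem_iUnion] at hx hx'
  obtain ⟨e, ⟨he, heS⟩, hxe⟩ := hx
  obtain ⟨e', ⟨he', heT⟩, hxe'⟩ := hx'
  have hne : e ≠ e' := by
    rintro rfl
    induction e with
    | h u v => exact Set.disjoint_left.1 hST (heS u (by simp)) (heT u (by simp))
  obtain ⟨w, hw, hw', -⟩ := E.inter_subset e he e' he' hne x ⟨hxe, hxe'⟩
  exact Set.disjoint_left.1 hST (heS w hw) (heT w hw')

theorem PlaneEmbedding.disjoint_insert_carrier_compl (E : PlaneEmbedding G) {S : Set V} {v : V}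
    (hv : v ∉ S) :
    Disjoint (insert (E.point v) E.carrierᶜ)
      (⋃ e ∈ {e ∈ G.edgeSet | ∀ w ∈ e, w ∈ S}, E.curve e) := by
  rw [Set.disjoint_left]
  intro x hx hx'
  simp only [Set.mem_iUnion] at hx'
  obtain ⟨e, ⟨he, heS⟩, hxe⟩ := hx'
  rcases hx with rfl | hx
  · exact hv (heS v (E.mem_of_point_mem e he v hxe))
  · exact hx (Or.inr (Set.mem_biUnion he hxe))

theorem LinkedIn.mem {S : Set V} {a b : V} (h : LinkedIn G S a b) (hab : a ≠ b) :
    a ∈ S ∧ b ∈ S := by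
  rcases Relation.ReflTransGen.cases_head h with h1 | ⟨c, hc, -⟩
  · exact absurd h1 hab
  rcases Relation.ReflTransGen.cases_tail h with h2 | ⟨d, -, hd⟩
  · exact absurd h2.symm hab
  exact ⟨hc.2.1, hd.2.2⟩

/-- Four vertices of an outerplanar graph cannot be linked by disjoint walks in all three ways of
pairing them up: otherwise the walks, together with curves to the four vertices from a point of
the unbounded face, would form a drawing of the complete graph on five vertices. -/
theorem IsOuterplanar.not_linked [Finite V] (hG : IsOuterplanar G) {a b c d : V}
    {S₁ T₁ S₂ T₂ S₃ T₃ : Set V} (hab : a ≠ b) (hac : a ≠ c) (had : a ≠ d) (hbc : b ≠ c)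
    (hbd : b ≠ d) (hcd : c ≠ d)
    (h₁ : Disjoint S₁ T₁) (hS₁ : LinkedIn G S₁ a b) (hT₁ : LinkedIn G T₁ c d)
    (h₂ : Disjoint S₂ T₂) (hS₂ : LinkedIn G S₂ a c) (hT₂ : LinkedIn G T₂ b d)
    (h₃ : Disjoint S₃ T₃) (hS₃ : LinkedIn G S₃ a d) (hT₃ : LinkedIn G T₃ b c) : False := by
  obtain ⟨E, F, ⟨z, hz, rfl⟩, -, hF⟩ := hG
  have inj : ∀ {x y}, x ≠ y → E.point x ≠ E.point y := fun h => E.point_injective.ne h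
  have hne : ∀ v, z ≠ E.point v := fun v e => hz (Or.inl ⟨v, e.symm⟩)
  obtain ⟨Za, fa, hZa, sa⟩ := E.exists_chain_of_mem_frontier hz (hF a)
  obtain ⟨Zb, fb, hZb, sb⟩ := E.exists_chain_of_mem_frontier hz (hF b)
  obtain ⟨Zc, fc, hZc, sc⟩ := E.exists_chain_of_mem_frontier hz (hF c)
  obtain ⟨Zd, fd, hZd, sd⟩ := E.exists_chain_of_mem_frontier hz (hF d)
  obtain ⟨Pab, fab, hPab, sab⟩ := E.exists_chain_of_linkedIn hS₁ hab
  obtain ⟨Pcd, fcd, hPcd, scd⟩ := E.exists_chain_of_linkedIn hT₁ hcd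
  obtain ⟨Pac, fac, hPac, sac⟩ := E.exists_chain_of_linkedIn hS₂ hac
  obtain ⟨Pbd, fbd, hPbd, sbd⟩ := E.exists_chain_of_linkedIn hT₂ hbd
  obtain ⟨Pad, fad, hPad, sad⟩ := E.exists_chain_of_linkedIn hS₃ had
  obtain ⟨Pbc, fbc, hPbc, sbc⟩ := E.exists_chain_of_linkedIn hT₃ hbc
  have l : ∀ {v : V} {S T : Set V}, Disjoint S T → v ∈ S → v ∉ T :=
    fun h hv hv' => Set.disjoint_left.1 h hv hv'
  have ma := (hS₁.mem hab); have mc := (hT₁.mem hcd)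
  have ma' := (hS₂.mem hac); have mb := (hT₂.mem hbd)
  have ma'' := (hS₃.mem had); have mb' := (hT₃.mem hbc)
  have key : ∀ {v : V} {S : Set V} {x y : ℝ × ℝ} {Z P : Set (ℝ × ℝ)} {f g : ℝ × ℝ → ZMod 2},
      v ∉ S → PolygonalChain z (E.point v) Z f → Z ⊆ insert (E.point v) E.carrierᶜ →
      PolygonalChain x y P g → P ⊆ (⋃ e ∈ {e ∈ G.edgeSet | ∀ w ∈ e, w ∈ S}, E.curve e) →
      crossParity z (E.point v) f x y g = 0 := fun hv hZ sZ hP sP =>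
    hZ.crossParity_eq_zero hP ((E.disjoint_insert_carrier_compl hv).mono sZ sP)
  exact not_disjoint_drawing_of_five_points (inj hab) (inj hac) (inj had) (inj hbc) (inj hbd)
    (inj hcd) (hne a) (hne b) (hne c) (hne d)
    (key (l h₃ ma''.1) hZa sa hPbc sbc) (key (l h₂ ma'.1) hZa sa hPbd sbd)
    (key (l h₁ ma.1) hZa sa hPcd scd) (key (l h₂.symm mb.1) hZb sb hPac sac)
    (key (l h₃.symm mb'.1) hZb sb hPad sad) (key (l h₁ ma.2) hZb sb hPcd scd)
    (key (l h₁.symm mc.1) hZc sc hPab sab) (key (l h₃.symm mb'.2) hZc sc hPad sad)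
    (key (l h₂ ma'.2) hZc sc hPbd sbd) (key (l h₁.symm mc.2) hZd sd hPab sab)
    (key (l h₂.symm mb.2) hZd sd hPac sac) (key (l h₃ ma''.2) hZd sd hPbc sbc)
    (hPab.crossParity_eq_zero hPcd ((E.disjoint_biUnion_curve h₁).mono sab scd))
    (hPac.crossParity_eq_zero hPbd ((E.disjoint_biUnion_curve h₂).mono sac sbd))
    (hPad.crossParity_eq_zero hPbc ((E.disjoint_biUnion_curve h₃).mono sad sbc))

end Embedding

/-! ### Separation in outerplanar graphs -/

section Linkage

variable {V : Type*} {G : SimpleGraph V}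

theorem LinkedIn.mono {S T : Set V} (hST : S ⊆ T) {a b : V} (h : LinkedIn G S a b) :
    LinkedIn G T a b :=
  Relation.ReflTransGen.mono (fun _ _ h => ⟨h.1, hST h.2.1, hST h.2.2⟩) _ _ h

theorem LinkedIn.symm {S : Set V} {a b : V} (h : LinkedIn G S a b) : LinkedIn G S b a :=
  have : Std.Symm fun x y => G.Adj x y ∧ x ∈ S ∧ y ∈ S := ⟨fun _ _ h => ⟨h.1.symm, h.2.2, h.2.1⟩⟩
  Relation.ReflTransGen.stdSymm.symm _ _ h

theorem LinkedIn.single {S : Set V} {a b : V} (hab : G.Adj a b) (ha : a ∈ S) (hb : b ∈ S) :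
    LinkedIn G S a b :=
  Relation.ReflTransGen.single ⟨hab, ha, hb⟩

theorem LinkedIn.trans {S : Set V} {a b c : V} (h : LinkedIn G S a b) (h' : LinkedIn G S b c) :
    LinkedIn G S a c :=
  Relation.ReflTransGen.trans h h'

/-- The component of `r` in the subgraph of `G` induced on `S`; it is `{r}` if `r ∉ S`. -/
def component (G : SimpleGraph V) (S : Set V) (r : V) : Set V := {x | LinkedIn G S r x}

theorem mem_component_self (S : Set V) (r : V) : r ∈ component G S r := Relation.ReflTransGen.refl

theorem component_subset {S : Set V} {r : V} (hr : r ∈ S) : component G S r ⊆ S := by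
  intro x hx
  by_cases h : r = x
  · exact h ▸ hr
  · exact (LinkedIn.mem hx h).2

theorem mem_component_of_adj {S : Set V} {r x y : V} (hr : r ∈ S) (hx : x ∈ component G S r)
    (hy : y ∈ S) (h : G.Adj x y) : y ∈ component G S r :=
  LinkedIn.trans hx (.single h (component_subset hr hx) hy)

theorem linkedIn_component {S : Set V} {r x y : V} (hx : x ∈ component G S r)
    (hy : y ∈ component G S r) : LinkedIn G (component G S r) x y := by
  have key : ∀ z, LinkedIn G S r z → LinkedIn G (component G S r) r z := by
    intro z hz
    induction hz with
    | refl => exact .refl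
    | tail h1 h2 ih => exact ih.trans (.single h2.1 h1 (Relation.ReflTransGen.tail h1 h2))
  exact (key x hx).symm.trans (key y hy)

theorem exists_adj_of_linkedIn {R : Set V} {r w : V} (h : LinkedIn G R r w) (hrw : r ≠ w) :
    ∃ x ∈ component G (R \ {w}) r, G.Adj x w := by
  have key : ∀ z, LinkedIn G R r z → (z ≠ w ∧ z ∈ component G (R \ {w}) r) ∨
      ∃ x ∈ component G (R \ {w}) r, G.Adj x w := by
    intro z hz
    induction hz with
    | refl => exact .inl ⟨hrw, mem_component_self _ _⟩
    | @tail x z h1 h2 ih =>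
      rcases ih with ⟨hne, hx⟩ | h
      · by_cases hz : z = w
        · exact .inr ⟨x, hx, hz ▸ h2.1⟩
        · exact .inl ⟨hz, LinkedIn.trans hx (.single h2.1 ⟨h2.2.1, hne⟩ ⟨h2.2.2, hz⟩)⟩
      · exact .inr h
  exact (key w h).resolve_left fun h => h.1 rfl

/-- The cops on `u` and `v` confine the robber to the connected set `R`. Unless one of the cops is
not needed for this, `u` and `v` are connected outside `R`. -/
structure IsTerritory (G : SimpleGraph V) (u v : V) (R : Set V) : Prop where
  ne : u ≠ v
  left_notMem : u ∉ R
  right_notMem : v ∉ R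
  linked : ∀ x ∈ R, ∀ y ∈ R, LinkedIn G R x y
  boundary : ∀ x ∈ R, ∀ y, G.Adj x y → y ∈ R ∨ y = u ∨ y = v
  outside : (∀ x ∈ R, ¬ G.Adj u x) ∨ (∀ x ∈ R, ¬ G.Adj v x) ∨
    ∃ K, Disjoint K R ∧ LinkedIn G K u v

theorem IsTerritory.symm {u v : V} {R : Set V} (h : IsTerritory G u v R) :
    IsTerritory G v u R where
  ne := h.ne.symm
  left_notMem := h.right_notMem
  right_notMem := h.left_notMem
  linked := h.linked
  boundary x hx y hxy := (h.boundary x hx y hxy).imp_right Or.symm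
  outside := by
    rcases h.outside with h1 | h1 | ⟨K, hK, h1⟩
    · exact .inr (.inl h1)
    · exact .inl h1
    · exact .inr (.inr ⟨K, hK, h1.symm⟩)

theorem isTerritory_component {u v r : V} {S : Set V} (huv : u ≠ v) (hr : r ∈ S) (hu : u ∉ S)
    (hv : v ∉ S)
    (hb : ∀ x ∈ component G S r, ∀ y, G.Adj x y → y ∈ S ∨ y = u ∨ y = v)
    (ho : (∀ x ∈ component G S r, ¬ G.Adj u x) ∨ (∀ x ∈ component G S r, ¬ G.Adj v x) ∨
      ∃ K, Disjoint K S ∧ LinkedIn G K u v) : IsTerritory G u v (component G S r) where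
  ne := huv
  left_notMem h := hu (component_subset hr h)
  right_notMem h := hv (component_subset hr h)
  linked _ hx _ hy := linkedIn_component hx hy
  boundary x hx y hxy :=
    (hb x hx y hxy).imp_left fun hy => mem_component_of_adj hr hx hy hxy
  outside := ho.imp_right (Or.imp_right fun ⟨K, hK, h⟩ =>
    ⟨K, hK.mono_right (component_subset hr), h⟩)

/-- A neighbour `w` of `u` separates, within the territory `R`, the remaining neighbours of `u` from
those of `v`. If no `w` did, take `w` and a component `C` of `R - w` adjacent to both `u` and `v`,
with `C` as small as possible, and let `w'` in `C` be another neighbour of `u`. A component `C'` of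
`R - w'` adjacent to both `u` and `v` contains `w`, since otherwise it is a part of `C`. Now
`u, w, w', v` are linked in all three ways: `w'` to `v` through `C`, `w` to `v` through `C'`, and
`u` to `v` outside `R`. -/
theorem IsTerritory.exists_separating [Finite V] (hG : IsOuterplanar G) {u v : V} {R : Set V}
    (h : IsTerritory G u v R) (hu : ∃ w ∈ R, G.Adj u w) :
    ∃ w ∈ R, G.Adj u w ∧ ∀ r ∈ R \ {w}, (∀ x ∈ component G (R \ {w}) r, ¬ G.Adj u x) ∨
      ∀ x ∈ component G (R \ {w}) r, ¬ G.Adj v x := by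
  rcases h.outside with h1 | h1 | ⟨K, hKR, hK⟩
  · obtain ⟨w, hw, huw⟩ := hu
    exact absurd huw (h1 w hw)
  · obtain ⟨w, hw, huw⟩ := hu
    exact ⟨w, hw, huw, fun r hr => .inr fun x hx => h1 x (component_subset hr hx).1⟩
  by_contra! hcon
  obtain ⟨w₀, hw₀, huw₀⟩ := hu
  let bad : Set (V × V) := {p | p.1 ∈ R ∧ G.Adj u p.1 ∧ p.2 ∈ R \ {p.1} ∧
    (∃ x ∈ component G (R \ {p.1}) p.2, G.Adj u x) ∧
      ∃ x ∈ component G (R \ {p.1}) p.2, G.Adj v x}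
  have hbad : ∀ w ∈ R, G.Adj u w → ∃ r, (w, r) ∈ bad := fun w hw huw => by
    obtain ⟨r, hr, h2, h3⟩ := hcon w hw huw
    exact ⟨r, hw, huw, hr, h2, h3⟩
  obtain ⟨r₀, hr₀⟩ := hbad w₀ hw₀ huw₀
  obtain ⟨⟨w, r⟩, ⟨hwR, huw, hr, ⟨w', hw', huw'⟩, y, hy, hvy⟩, hmin⟩ :=
    Set.exists_min_image bad (fun p => (component G (R \ {p.1}) p.2).ncard) (Set.toFinite _)
      ⟨_, hr₀⟩
  dsimp only at hwR huw hr hw' hy hmin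
  have hw'R := component_subset hr hw'
  obtain ⟨r', hb'⟩ := hbad w' hw'R.1 huw'
  have hle := hmin _ hb'
  obtain ⟨-, -, hr', -, y', hy', hvy'⟩ := hb'
  dsimp only at hr' hy' hle
  have hww' : w ≠ w' := fun e => hw'R.2 e.symm
  by_cases hw : w ∈ component G (R \ {w'}) r'
  · have hnu : ∀ {x}, x ∈ R → u ≠ x := fun hx e => h.left_notMem (e ▸ hx)
    have hnv : ∀ {x}, x ∈ R → x ≠ v := fun hx e => h.right_notMem (e ▸ hx)
    have link : ∀ {C : Set V} {a y : V}, a ∈ C → y ∈ C → LinkedIn G C a y → G.Adj v y →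
        LinkedIn G (insert v C) a v := fun ha hy hl hvy =>
      (hl.mono (Set.subset_insert _ _)).trans (.single hvy.symm (.inr hy) (.inl rfl))
    have disj : ∀ {a b : V}, a ∈ R → b ∈ R \ {a} →
        Disjoint {u, a} (insert v (component G (R \ {a}) b)) := fun ha hb => by
      rw [Set.disjoint_left]
      rintro x (rfl | rfl) (rfl | hx)
      · exact h.ne rfl
      · exact h.left_notMem (component_subset hb hx).1
      · exact h.right_notMem ha
      · exact (component_subset hb hx).2 rfl
    exact hG.not_linked (hnu hwR) (hnu hw'R.1) h.ne hww' (hnv hwR) (hnv hw'R.1)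
      (disj hwR hr) (.single huw (.inl rfl) (.inr rfl))
      (link hw' hy (linkedIn_component hw' hy) hvy)
      (disj hw'R.1 hr') (.single huw' (.inl rfl) (.inr rfl))
      (link hw hy' (linkedIn_component hw hy') hvy')
      hKR hK (h.linked w hwR w' hw'R.1)
  · -- `C'` is a proper part of `C`
    obtain ⟨x, hx, hxw'⟩ := exists_adj_of_linkedIn (h.linked r' hr'.1 w' hw'R.1) hr'.2
    have hsub : component G (R \ {w'}) r' ⊆ R \ {w} := fun z hz =>
      ⟨(component_subset hr' hz).1, fun e => hw (e ▸ hz)⟩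
    have hsub' : component G (R \ {w'}) r' ⊆ component G (R \ {w}) r := fun z hz =>
      LinkedIn.trans hw' (.trans (.single hxw'.symm hw'R (hsub hx))
        ((linkedIn_component hx hz).mono hsub))
    have hlt := Set.ncard_lt_ncard (Set.ssubset_iff_of_subset hsub' |>.2 ⟨w', hw',
      fun hm => (component_subset hr' hm).2 rfl⟩) (Set.toFinite _)
    omega

theorem IsOuterplanar.eq_or_eq_of_common_neighbors [Finite V] (hG : IsOuterplanar G)
    {u v x y z : V} (huv : u ≠ v) (hxy : x ≠ y) (hux : G.Adj u x) (hvx : G.Adj v x)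
    (huy : G.Adj u y) (hvy : G.Adj v y) (huz : G.Adj u z) (hvz : G.Adj v z) : z = x ∨ z = y := by
  by_contra! hz
  have link : ∀ {a b : V}, G.Adj v a → G.Adj v b → LinkedIn G {a, v, b} a b := fun ha hb =>
    (LinkedIn.single ha.symm (by simp) (by simp)).trans (.single hb (by simp) (by simp))
  have disj : ∀ {a b c : V}, G.Adj u b → G.Adj u c → G.Adj v a → a ≠ b → a ≠ c →
      Disjoint {u, a} ({b, v, c} : Set V) := fun hub huc hva hab hac => by
    have := hub.ne; have := huc.ne; have := hva.ne.symm
    rw [Set.disjoint_left]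
    rintro x (rfl | rfl) <;> simp [*]
  exact hG.not_linked hux.ne huy.ne huz.ne hxy hz.1.symm hz.2.symm
    (disj huy huz hvx hxy hz.1.symm) (.single hux (by simp) (by simp)) (link hvy hvz)
    (disj hux huz hvy hxy.symm hz.2.symm) (.single huy (by simp) (by simp)) (link hvx hvz)
    (disj hux huy hvz hz.1 hz.2) (.single huz (by simp) (by simp)) (link hvx hvy)

end Linkage

/-! ### The pursuit of a visible robber -/

section Pursuit

variable {V : Type*} {G : SimpleGraph V}

/-- With the cops to move, cops on `u ≠ v` can force within `n` further rounds that the robber, now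
on `r`, is captured or adjacent to a cop at the start of a round, in the game in which the robber
is always visible to the cops and the cops are always on different vertices when it is their
turn. -/
inductive CopsWin (G : SimpleGraph V) : ℕ → V → V → V → Prop
  | adj {n : ℕ} {u v r : V} (huv : u ≠ v) (h : G.Adj u r ∨ G.Adj v r) : CopsWin G n u v r
  | step {n : ℕ} {u v r : V} (u' v' : V) (huv : u ≠ v) (hu : MayMove G u u') (hv : MayMove G v v')
      (h : ∀ r', MayMove G r r' → r' ≠ u' → r' ≠ v' → CopsWin G n u' v' r') :
      CopsWin G (n + 1) u v r

theorem CopsWin.ne {n : ℕ} {u v r : V} (h : CopsWin G n u v r) : u ≠ v := by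
  cases h <;> assumption

theorem CopsWin.symm {n : ℕ} {u v r : V} (h : CopsWin G n u v r) : CopsWin G n v u r := by
  induction h with
  | adj huv h => exact .adj huv.symm h.symm
  | step u' v' huv hu hv _ ih => exact .step v' u' huv.symm hv hu fun r' h1 h2 h3 => ih r' h1 h3 h2

theorem CopsWin.mono {n m : ℕ} (hnm : n ≤ m) {u v r : V} (h : CopsWin G n u v r) :
    CopsWin G m u v r := by
  induction h generalizing m with
  | adj huv h => exact .adj huv h
  | step u' v' huv hu hv _ ih =>
    obtain ⟨m, rfl⟩ := Nat.exists_eq_succ_of_ne_zero (by omega : m ≠ 0)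
    exact .step u' v' huv hu hv fun r' h1 h2 h3 => ih r' h1 h2 h3 (by omega)

theorem exists_copsWin_of_step [Finite V] {u v r : V} (u' v' : V) (huv : u ≠ v)
    (hu : MayMove G u u') (hv : MayMove G v v')
    (h : ∀ r', MayMove G r r' → r' ≠ u' → r' ≠ v' → ∃ n, CopsWin G n u' v' r') :
    ∃ n, CopsWin G n u v r := by
  have h' : ∀ r', ∃ n, MayMove G r r' → r' ≠ u' → r' ≠ v' → CopsWin G n u' v' r' := fun r' => by
    by_cases hr : MayMove G r r' ∧ r' ≠ u' ∧ r' ≠ v'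
    · obtain ⟨n, hn⟩ := h r' hr.1 hr.2.1 hr.2.2
      exact ⟨n, fun _ _ _ => hn⟩
    · exact ⟨0, fun h1 h2 h3 => absurd ⟨h1, h2, h3⟩ hr⟩
  choose n hn using h'
  obtain ⟨N, hN⟩ := Set.finite_range n |>.bddAbove
  exact ⟨N + 1, .step u' v' huv hu hv fun r' h1 h2 h3 =>
    (hn r' h1 h2 h3).mono (hN ⟨r', rfl⟩)⟩

/-- If the cop on `g` keeps the robber in `R`, then the other cop can walk anywhere. Where the walk
has to pass through `g`, the cops swap their roles, so as not to meet. -/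
theorem exists_copsWin_of_guard [Finite V] (hconn : G.Connected) {g y : V} {R : Set V}
    (hyg : y ≠ g) (hg : ∀ r ∈ R, ∀ r', G.Adj r r' → r' ∈ R ∨ r' = g ∨ G.Adj g r')
    (hy : ∀ r ∈ R, ∃ n, CopsWin G n g y r) {x : V} (hxg : x ≠ g) :
    ∀ r ∈ R, ∃ n, CopsWin G n g x r := by
  let P : V → Prop := fun x => ∀ r ∈ R, ∃ n, CopsWin G n g x r
  let Q : V → Prop := fun x => (x ≠ g → P x) ∧ (x = g → ∃ z, G.Adj g z ∧ P z)
  suffices Q x from this.1 hxg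
  clear hxg
  have hrt := (SimpleGraph.reachable_iff_reflTransGen y x).1 (hconn.preconnected y x)
  have stay : ∀ r ∈ R, ∀ r', MayMove G r r' → r' ∈ R ∨ r' = g ∨ G.Adj g r' := by
    rintro r hr r' (rfl | h)
    · exact .inl hr
    · exact hg r hr r' h
  induction hrt with
  | refl => exact ⟨fun _ => hy, fun e => absurd e hyg⟩
  | @tail a b _ hab ih =>
    refine ⟨fun hb r hr => ?_, fun hb => ?_⟩
    · by_cases ha : a = g
      · obtain ⟨z, hz, hPz⟩ := ih.2 ha
        refine exists_copsWin_of_step z g hb.symm (.inr hz) (.inr (ha ▸ hab.symm)) ?_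
        intro r' hr' hz' hg'
        rcases stay r hr r' hr' with h | h | h
        · obtain ⟨n, hn⟩ := hPz r' h
          exact ⟨n, hn.symm⟩
        · exact absurd h hg'
        · exact ⟨0, .adj hz.ne' (.inr h)⟩
      · refine exists_copsWin_of_step g a hb.symm (.inl rfl) (.inr hab.symm) ?_
        intro r' hr' hg' _
        rcases stay r hr r' hr' with h | h | h
        · exact ih.1 ha r' h
        · exact absurd h hg'
        · exact ⟨0, .adj (Ne.symm ha) (.inl h)⟩
    · have ha : a ≠ g := fun e => hab.ne (e.trans hb.symm)
      exact ⟨a, hb ▸ hab.symm, ih.1 ha⟩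

/-- The cops win by shrinking the territory of the robber: the cop on `u` moves to a vertex `w` as
in `IsTerritory.exists_separating`. From there, they keep the robber away from `u` as well, since
`u` is adjacent to `w`. Hence if the robber is now in a component not adjacent to `v`, the other
cop is free to walk to `u`. -/
theorem IsTerritory.exists_copsWin [Finite V] (hconn : G.Connected) (hG : IsOuterplanar G)
    {u v : V} {R : Set V} (h : IsTerritory G u v R) : ∀ r ∈ R, ∃ n, CopsWin G n u v r := by
  induction hN : R.ncard using Nat.strong_induction_on generalizing u v R with
  | _ N ih =>
  subst hN
  wlog hu : ∃ w ∈ R, G.Adj u w generalizing u v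
  · intro r hr
    by_cases hv : ∃ w ∈ R, G.Adj v w
    · obtain ⟨n, hn⟩ := this h.symm hv r hr
      exact ⟨n, hn.symm⟩
    · -- no edge leaves `R`, which is impossible in a connected graph
      push Not at hu hv
      have hrt := (SimpleGraph.reachable_iff_reflTransGen r u).1 (hconn.preconnected r u)
      have : u ∈ R := by
        refine hrt.head_induction_on (motive := fun a _ => a ∈ R → u ∈ R) id ?_ hr
        intro a c hac _ hcu ha
        rcases h.boundary a ha c hac with h1 | rfl | rfl
        · exact hcu h1
        · exact absurd hac.symm (hu a ha)
        · exact absurd hac.symm (hv a ha)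
      exact absurd this h.left_notMem
  obtain ⟨w, hw, huw, hsep⟩ := h.exists_separating hG hu
  have hvw : w ≠ v := fun e => h.right_notMem (e ▸ hw)
  intro r hr
  refine exists_copsWin_of_step w v h.ne (.inr huw) (.inl rfl) fun r' hrr' hr'w hr'v => ?_
  have hr' : r' ∈ R ∨ r' = u ∨ r' = v := by
    rcases hrr' with rfl | hrr'
    · exact .inl hr
    · exact h.boundary r hr r' hrr'
  rcases hr' with hr' | rfl | rfl
  · have hr'' : r' ∈ R \ {w} := ⟨hr', hr'w⟩
    have hlt : (component G (R \ {w}) r').ncard < R.ncard :=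
      (Set.ncard_le_ncard (component_subset hr'')).trans_lt
        (Set.ncard_sdiff_singleton_lt_of_mem hw)
    have hbd : ∀ x ∈ component G (R \ {w}) r', ∀ y, G.Adj x y →
        y ∈ R \ {w} ∨ y = w ∨ y = u ∨ y = v := by
      intro x hx y hxy
      rcases h.boundary x (component_subset hr'' hx).1 y hxy with h1 | h1
      · by_cases hyw : y = w
        · exact .inr (.inl hyw)
        · exact .inl ⟨h1, hyw⟩
      · exact .inr (.inr h1)
    rcases hsep r' hr'' with hnu | hnv
    · refine ih _ hlt (isTerritory_component hvw hr'' (fun e => e.2 rfl)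
        (fun e => h.right_notMem e.1) ?_ ?_) rfl r' (mem_component_self _ _)
      · intro x hx y hxy
        rcases hbd x hx y hxy with h1 | h1 | rfl | h1
        · exact .inl h1
        · exact .inr (.inl h1)
        · exact absurd hxy.symm (hnu x hx)
        · exact .inr (.inr h1)
      · rcases h.outside with h1 | h1 | ⟨K, hKR, hK⟩
        · exact absurd huw (h1 w hw)
        · exact .inr (.inl fun x hx => h1 x (component_subset hr'' hx).1)
        · refine .inr (.inr ⟨insert w K, ?_, ?_⟩)
          · rw [Set.disjoint_left] at hKR ⊢
            rintro x (rfl | hx) hx'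
            · exact hx'.2 rfl
            · exact hKR hx hx'.1
          · exact (LinkedIn.single huw.symm (.inl rfl) (.inr (hK.mem h.ne).1)).trans
              (hK.mono (Set.subset_insert _ _))
    · refine exists_copsWin_of_guard (R := component G (R \ {w}) r') hconn huw.ne ?_ ?_ hvw.symm r' (mem_component_self _ _)
      · intro x hx y hxy
        rcases hbd x hx y hxy with h1 | h1 | rfl | rfl
        · exact .inl (mem_component_of_adj hr'' hx h1 hxy)
        · exact .inr (.inl h1)
        · exact .inr (.inr huw.symm)
        · exact absurd hxy.symm (hnv x hx)
      · refine ih _ hlt (isTerritory_component huw.ne' hr'' (fun e => e.2 rfl)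
          (fun e => h.left_notMem e.1) ?_ ?_) rfl
        · intro x hx y hxy
          rcases hbd x hx y hxy with h1 | h1 | h1 | rfl
          · exact .inl h1
          · exact .inr (.inl h1)
          · exact .inr (.inr h1)
          · exact absurd hxy.symm (hnv x hx)
        · refine .inr (.inr ⟨{w, u}, ?_, .single huw.symm (by simp) (by simp)⟩)
          rw [Set.disjoint_left]
          rintro x (rfl | rfl) hx
          · exact hx.2 rfl
          · exact h.left_notMem hx.1
  · exact ⟨0, .adj hvw (.inl huw.symm)⟩
  · exact absurd rfl hr'v

end Pursuit

/-! ### The strategy against an invisible robber -/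

section Strategy

variable {V : Type*} {G : SimpleGraph V}

/-- A positional way to play: two cops, on `p.1` and `p.2`, that last observed `o` should move to
`q`. An invisible robber is captured wherever they are, and a visible one is captured or the number
of rounds needed decreases. -/
structure IsGoodReply (G : SimpleGraph V) (p : V × V) (o : Option V) (q : V × V) : Prop where
  mayMove : MayMove G p.1 q.1 ∧ MayMove G p.2 q.2
  invisible : o = none → p.1 ≠ p.2 → ∀ x, G.Adj p.1 x → G.Adj p.2 x → x = q.1 ∨ x = q.2
  visible : ∀ r ∈ o, ∀ n, CopsWin G n p.1 p.2 r → (r = q.1 ∨ r = q.2) ∨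
    ∃ m < n, ∀ r', MayMove G r r' → r' ≠ q.1 → r' ≠ q.2 → CopsWin G m q.1 q.2 r'

theorem exists_isGoodReply [Finite V] (hG : IsOuterplanar G) (p : V × V) (o : Option V) :
    ∃ q, IsGoodReply G p o q := by
  obtain ⟨u, v⟩ := p
  rcases o with _ | r
  · suffices ∃ q : V × V, (MayMove G u q.1 ∧ MayMove G v q.2) ∧
        (u ≠ v → ∀ x, G.Adj u x → G.Adj v x → x = q.1 ∨ x = q.2) by
      obtain ⟨q, h1, h2⟩ := this
      exact ⟨q, h1, fun _ => h2, by simp⟩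
    by_cases hx : u ≠ v ∧ ∃ x, G.Adj u x ∧ G.Adj v x
    · obtain ⟨huv, x, hux, hvx⟩ := hx
      by_cases hy : ∃ y, x ≠ y ∧ G.Adj u y ∧ G.Adj v y
      · obtain ⟨y, hxy, huy, hvy⟩ := hy
        exact ⟨(x, y), ⟨.inr hux, .inr hvy⟩, fun _ z huz hvz =>
          hG.eq_or_eq_of_common_neighbors huv hxy hux hvx huy hvy huz hvz⟩
      · push Not at hy
        refine ⟨(x, v), ⟨.inr hux, .inl rfl⟩, fun _ z huz hvz => .inl ?_⟩
        by_contra hzx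
        exact hy z (Ne.symm hzx) huz hvz
    · push Not at hx
      exact ⟨(u, v), ⟨.inl rfl, .inl rfl⟩, fun huv z huz hvz => absurd hvz (hx huv z huz)⟩
  · classical
    by_cases hw : ∃ n, CopsWin G n u v r
    · -- a move that is good for the least possible number of rounds is good for all others
      suffices ∃ q : V × V, (MayMove G u q.1 ∧ MayMove G v q.2) ∧ ((r = q.1 ∨ r = q.2) ∨
          ∃ m < Nat.find hw, ∀ r', MayMove G r r' → r' ≠ q.1 → r' ≠ q.2 →
            CopsWin G m q.1 q.2 r') by
        obtain ⟨q, h1, h2⟩ := this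
        refine ⟨q, h1, by simp, fun r' hr' n hn => ?_⟩
        obtain rfl : r = r' := by simpa using hr'
        exact h2.imp_right fun ⟨m, hm, h⟩ => ⟨m, hm.trans_le (Nat.find_min' hw hn), h⟩
      have hfind := Nat.find_spec hw
      generalize Nat.find hw = N at hfind ⊢
      cases hfind with
      | adj huv h =>
        rcases h with h | h
        · exact ⟨(r, v), ⟨.inr h, .inl rfl⟩, .inl (.inl rfl)⟩
        · exact ⟨(u, r), ⟨.inl rfl, .inr h⟩, .inl (.inr rfl)⟩
      | @step n _ _ _ u' v' huv hu hv h =>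
        exact ⟨(u', v'), ⟨hu, hv⟩, .inr ⟨n, n.lt_succ_self, h⟩⟩
    · refine ⟨(u, v), ⟨.inl rfl, .inl rfl⟩, by simp, fun r' hr' n hn => ?_⟩
      obtain rfl : r = r' := by simpa using hr'
      exact absurd ⟨n, hn⟩ hw

/-- The positions of two cops that start on `init` and always play `reply`. The cops move once per
round but observe twice; they reply to the observation after the move of the robber. -/
def positions (reply : V × V → Option V → V × V) (init : V × V) : List (Option V) → V × V
  | [] => init
  | [o] => reply init o
  | o :: _ :: l => reply (positions reply init l) o

/-- The strategy of two cops that start on `init` and always play `reply`. -/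
def positionalStrategy (reply : V × V → Option V → V × V) (init : V × V) : CopStrategy V 2 :=
  fun l => ![(positions reply init l).1, (positions reply init l).2]

/-- The positions of the two cops of `positionalStrategy` in round `n`. -/
noncomputable def copPair (G : SimpleGraph V) (reply : V × V → Option V → V × V) (init : V × V)
    (r : ℕ → V) : ℕ → V × V
  | 0 => init
  | n + 1 => positions reply init (observations G (positionalStrategy reply init) r n)

variable {reply : V × V → Option V → V × V} {init : V × V}

theorem copPosition_eq (r : ℕ → V) (n : ℕ) :
    copPosition G (positionalStrategy reply init) r n =
      ![(copPair G reply init r n).1, (copPair G reply init r n).2] := by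
  cases n <;> rfl

theorem observations_eq_cons (r : ℕ → V) (n : ℕ) : ∃ l,
    observations G (positionalStrategy reply init) r n =
      observe G (copPosition G (positionalStrategy reply init) r n) (r n) :: l := by
  cases n <;> exact ⟨_, rfl⟩

theorem copPair_succ (r : ℕ → V) (n : ℕ) :
    copPair G reply init r (n + 1) = reply (copPair G reply init r n)
      (observe G (copPosition G (positionalStrategy reply init) r n) (r n)) := by
  cases n <;> rfl

theorem copPair_congr {r r' : ℕ → V} {n : ℕ}
    (h : observations G (positionalStrategy reply init) r' n =
      observations G (positionalStrategy reply init) r n) :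
    copPair G reply init r' n = copPair G reply init r n := by
  cases n with
  | zero => rfl
  | succ n => exact congrArg (positions reply init) (congrArg (fun l => l.tail.tail) h)

theorem caughtOnArrival_iff (r : ℕ → V) (n : ℕ) :
    CaughtOnArrival G (positionalStrategy reply init) r n ↔
      r n = (copPair G reply init r n).1 ∨ r n = (copPair G reply init r n).2 := by
  simp [CaughtOnArrival, copPosition_eq, Fin.exists_fin_two, eq_comm]

theorem caughtByMove_iff (r : ℕ → V) (n : ℕ) :
    CaughtByMove G (positionalStrategy reply init) r n ↔
      r n = (copPair G reply init r (n + 1)).1 ∨ r n = (copPair G reply init r (n + 1)).2 := by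
  simp [CaughtByMove, copPosition_eq, Fin.exists_fin_two, eq_comm]

theorem invisible_iff (p : V × V) (r : V) :
    Invisible G ![p.1, p.2] r ↔ G.Adj p.1 r ∧ G.Adj p.2 r := by
  simp [Invisible, Fin.forall_fin_two]

/-- The strategy given by good replies captures the robber, and at that time the cops were on
different vertices, unless the robber has moved onto a cop. -/
theorem exists_caught (hreply : ∀ p o, IsGoodReply G p o (reply p o)) {r : ℕ → V}
    (hr : IsRobberPlay G r) {m n : ℕ}
    (hn : ∀ k < n, ¬ CaughtOnArrival G (positionalStrategy reply init) r k ∧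
      ¬ CaughtByMove G (positionalStrategy reply init) r k)
    (hw : CopsWin G m (copPair G reply init r n).1 (copPair G reply init r n).2 (r n)) :
    ∃ n, (∀ k < n, ¬ CaughtOnArrival G (positionalStrategy reply init) r k ∧
      ¬ CaughtByMove G (positionalStrategy reply init) r k) ∧
      (CaughtOnArrival G (positionalStrategy reply init) r n ∨
        CaughtByMove G (positionalStrategy reply init) r n ∧
          (copPair G reply init r n).1 ≠ (copPair G reply init r n).2) := by
  induction m using Nat.strong_induction_on generalizing n with
  | _ m ih =>
  by_cases h1 : CaughtOnArrival G (positionalStrategy reply init) r n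
  · exact ⟨n, hn, .inl h1⟩
  by_cases h2 : CaughtByMove G (positionalStrategy reply init) r n
  · exact ⟨n, hn, .inr ⟨h2, hw.ne⟩⟩
  have hn' : ∀ k < n + 1, ¬ CaughtOnArrival G (positionalStrategy reply init) r k ∧
      ¬ CaughtByMove G (positionalStrategy reply init) r k := fun k hk => by
    rcases Nat.lt_succ_iff_lt_or_eq.1 hk with hk | rfl
    · exact hn k hk
    · exact ⟨h1, h2⟩
  by_cases h3 : CaughtOnArrival G (positionalStrategy reply init) r (n + 1)
  · exact ⟨n + 1, hn', .inl h3⟩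
  rw [caughtByMove_iff] at h2
  rw [caughtOnArrival_iff] at h3
  push Not at h3
  have hq := hreply (copPair G reply init r n)
    (observe G (copPosition G (positionalStrategy reply init) r n) (r n))
  rw [← copPair_succ (G := G) (reply := reply)] at hq
  rw [copPosition_eq, observe] at hq
  split_ifs at hq with hinv
  · rw [invisible_iff] at hinv
    exact absurd (hq.invisible rfl hw.ne _ hinv.1 hinv.2) h2
  · obtain ⟨m', hm', h⟩ := (hq.visible _ rfl m hw).resolve_left h2
    exact ih m' hm' hn' (h _ (hr n) h3.1 h3.2)

/-- A capture by cops coming from different vertices involves no chance: what the cops have observed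
determines their positions and either the position of the robber or the fact that they are
invisible, in which case the reply captures them on every common neighbour. -/
theorem surelyCaughtByMove (hreply : ∀ p o, IsGoodReply G p o (reply p o)) {r : ℕ → V} {n : ℕ}
    (h : CaughtByMove G (positionalStrategy reply init) r n)
    (hne : (copPair G reply init r n).1 ≠ (copPair G reply init r n).2) :
    SurelyCaughtByMove G (positionalStrategy reply init) r n := by
  intro r' _ hobs
  have hpair := copPair_congr hobs
  have hpos : copPosition G (positionalStrategy reply init) r' n =
      copPosition G (positionalStrategy reply init) r n := by
    rw [copPosition_eq, copPosition_eq, hpair]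
  have ho : observe G (copPosition G (positionalStrategy reply init) r n) (r' n) =
      observe G (copPosition G (positionalStrategy reply init) r n) (r n) := by
    obtain ⟨l, hl⟩ := observations_eq_cons (G := G) (reply := reply) (init := init) r n
    obtain ⟨l', hl'⟩ := observations_eq_cons (G := G) (reply := reply) (init := init) r' n
    rw [hl, hl', hpos] at hobs
    exact (List.cons.inj hobs).1
  rw [caughtByMove_iff, copPair_succ, hpos, hpair, ho]
  rw [caughtByMove_iff, copPair_succ] at h
  by_cases hinv : Invisible G (copPosition G (positionalStrategy reply init) r' n) (r' n)
  · have e : observe G (copPosition G (positionalStrategy reply init) r n) (r n) = none := by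
      rw [← ho, ← hpos]; exact if_pos hinv
    rw [hpos, copPosition_eq, invisible_iff] at hinv
    exact (hreply _ _).invisible e hne _ hinv.1 hinv.2
  · have e : observe G (copPosition G (positionalStrategy reply init) r n) (r n) = some (r' n) := by
      rw [← ho, ← hpos]; exact if_neg hinv
    have e' : r n = r' n := by
      rw [observe] at e
      split_ifs at e
      exact Option.some.inj e
    rwa [e'] at h ⊢

/-- Two cops who always are on different vertices lose nothing by the robber's invisibility. -/
theorem exists_isWinningStrategy [Finite V] (hG : IsOuterplanar G) (u v : V)
    (h : ∀ r, r ≠ u → r ≠ v → ∃ n, CopsWin G n u v r) :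
    ∃ σ : CopStrategy V 2, IsWinningStrategy G σ := by
  choose reply hreply using exists_isGoodReply hG
  refine ⟨positionalStrategy reply (u, v), fun r hr => ⟨fun n i => ?_, ?_⟩⟩
  · have := (hreply (copPair G reply (u, v) r n)
      (observe G (copPosition G (positionalStrategy reply (u, v)) r n) (r n))).mayMove
    rw [← copPair_succ (G := G) (reply := reply)] at this
    rw [copPosition_eq, copPosition_eq]
    fin_cases i
    · exact this.1
    · exact this.2
  · have : ∃ n, (∀ k < n, ¬ CaughtOnArrival G (positionalStrategy reply (u, v)) r k ∧
        ¬ CaughtByMove G (positionalStrategy reply (u, v)) r k) ∧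
        (CaughtOnArrival G (positionalStrategy reply (u, v)) r n ∨
          CaughtByMove G (positionalStrategy reply (u, v)) r n ∧
            (copPair G reply (u, v) r n).1 ≠ (copPair G reply (u, v) r n).2) := by
      by_cases h0 : CaughtOnArrival G (positionalStrategy reply (u, v)) r 0
      · exact ⟨0, by simp, .inl h0⟩
      · have h1 := h0
        rw [caughtOnArrival_iff] at h1
        push Not at h1
        obtain ⟨m, hm⟩ := h (r 0) h1.1 h1.2
        exact exists_caught hreply hr (n := 0) (by simp) hm
    obtain ⟨n, hn, hc⟩ := this
    exact ⟨n, hn, hc.imp_right fun hc => surelyCaughtByMove hreply hc.1 hc.2⟩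

end Strategy

theorem mainTheorem2 {V : Type*} [Finite V] (G : SimpleGraph V) (hconn : G.Connected)
    (hG : IsOuterplanar G) : hyperopicCopNumber G ≤ 2 := by
  suffices ∃ σ : CopStrategy V 2, IsWinningStrategy G σ from sInf_le ⟨2, rfl, this⟩
  obtain ⟨u⟩ := hconn.nonempty
  rcases subsingleton_or_nontrivial V with _ | _
  · exact exists_isWinningStrategy hG u u fun r hr => absurd (Subsingleton.elim r u) hr
  · obtain ⟨v, huv⟩ := hconn.preconnected.exists_adj_of_nontrivial u
    refine exists_isWinningStrategy hG u v fun r hru hrv => ?_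
    have hr : r ∈ ({u, v}ᶜ : Set V) := by simp [hru, hrv]
    refine (isTerritory_component huv.ne hr (by simp) (by simp) (fun x _ y _ => ?_)
      (.inr (.inr ⟨{u, v}, disjoint_compl_right, .single huv (by simp) (by simp)⟩))
      ).exists_copsWin hconn hG r (mem_component_self _ _)
    by_cases hy : y = u ∨ y = v
    · exact .inr hy
    · exact .inl hy
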